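/- A partition is a weakly decreasing sequence $\lambda=(\lambda_1,\lambda_2,\dots)$ of non-negative integers with finitely many non-zero terms. Its Ferrers diagram is $F(\lambda)=\{(i,j)\in\mathbb N^2 : i<\lambda_{j+1}\}$ (with $0\in\mathbb N$), and $I(\lambda)=\mathbb N^2\setminus F(\lambda)$, an ideal of the additive monoid $\mathbb N^2$. The integral closure of a monoid ideal $I\subseteq\mathbb N^2$ is the set of all $a\in\mathbb N^2$ such that, for some integer $\ell\ge 1$, $\ell a$ is a sum of $\ell$ elements of $I$; $I$ is integrally closed if it equals its integral closure. The partition $\lambda$ is called concave if $I(\lambda)$ is integrally closed. Write $\mathbf x^\lambda=x_1^{\lambda_1}x_2^{\lambda_2}\cdots$ and define the formal power series $$PC(\mathbf x)=\sum_{\lambda\text{ concave}}\mathbf x^\lambda,\qquad PC_r(x_1,\dots,x_r)=\sum_{\lambda\text{ concave},\ \lambda_{r+1}=0}\mathbf x^\lambda=PC(x_1,\dots,x_r,0,0,\dots).$$ **Theorem.** There are polynomials $Q_r(x_1,\dots,x_r)$, $r\ge 0$, such that for every $r\ge 0$ $$PC_r(x_1,\dots,x_r)=\frac{Q_r(x_1,\dots,x_r)}{\prod_{i=1}^r\bigl(1-\prod_{j=1}^i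 x_j^{1+i-j}\bigr)}$$ and 1. $Q_r$ has integer coefficients; 2. $Q_r(1,\dots,1)=1$; 3. the exponent vector of every monomial occurring in $Q_r$ is weakly decreasing; 4. $Q_r(x_1,\dots,x_r)=Q_{r+1}(x_1,\dots,x_r,0)$. Furthermore, the infinite product below converges in the ring of formal power series in $x_1,x_2,\dots$ with integer coefficients (with respect to coefficientwise convergence) to an invertible element, and $$PC(\mathbf x)=\frac{Q(\mathbf x)}{\prod_{i=1}^\infty\bigl(1-\prod_{j=1}^i x_j^{1+i-j}\bigr)},$$ where $Q$ is a formal power series with integer coefficients such that $Q(x_1,\dots,x_\ell,0,0,\dots)=Q_\ell(x_1,\dots,x_\ell)$ for every $\ell\ge 0$; in other words, $Q=1+\sum_{i=1}^\infty (Q_i-Q_{i-1})$, the sum converging coefficientwise. -/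

import Mathlib

open scoped MvPowerSeries.WithPiTopology

namespace ConcavePartition

noncomputable section

/-- An integer partition `(λ₁, λ₂, …)`: a weakly decreasing, finitely supported sequence of
natural numbers.  Indices are shifted by one: `l j` is `λ_{j+1}`. -/
def IsPartition (l : ℕ →₀ ℕ) : Prop := Antitone l

/-- The Ferrers diagram `{(i, j) ∈ ℕ² | i < λ_{j+1}}`. -/
def ferrers (l : ℕ →₀ ℕ) : Set (ℕ × ℕ) := {p | p.1 < l p.2}

/-- The monoid ideal of `ℕ²` attached to a partition: the complement of the Ferrers diagram. -/
def monoidIdeal (l : ℕ →₀ ℕ) : Set (ℕ × ℕ) := (ferrers l)ᶜ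

/-- The integral closure of a monoid ideal `I ⊆ ℕ²`: all `a` such that, for some `k ≥ 1`, the
multiple `k a` lies in the `k`-fold sum `I + ⋯ + I`
(that is, `(x^a)^k ∈ J^k` for the corresponding monomial ideal `J`). -/
def intClosure (I : Set (ℕ × ℕ)) : Set (ℕ × ℕ) :=
  {a | ∃ k : ℕ, 0 < k ∧ ∃ s : Fin k → ℕ × ℕ, (∀ i, s i ∈ I) ∧ ∑ i, s i = k • a}

/-- A partition is concave if its monoid ideal is integrally closed. -/
def IsConcave (l : ℕ →₀ ℕ) : Prop :=
  IsPartition l ∧ intClosure (monoidIdeal l) = monoidIdeal l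

open Classical in
/-- The formal sum `∑_{m ∈ S} x^m` over a set `S` of exponent vectors. -/
def genFun {σ : Type*} (S : Set (σ →₀ ℕ)) : MvPowerSeries σ ℤ :=
  fun m => if m ∈ S then 1 else 0

/-- `PC(x) = ∑_{λ concave} x^λ`, where `x_{j+1}` is the variable `X j`. -/
def PC : MvPowerSeries ℕ ℤ := genFun {l | IsConcave l}

/-- The exponent vectors `(λ₁, …, λ_r)` of the concave partitions `λ` with at most `r` parts,
i.e. with `λ_{r+1} = 0`. -/
def concaveVectors (r : ℕ) : Set (Fin r →₀ ℕ) :=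
  {m | ∃ l : ℕ →₀ ℕ, IsConcave l ∧ l r = 0 ∧ ∀ i : Fin r, l i = m i}

/-- `PC_r(x₁, …, x_r) = ∑_{λ concave, λ_{r+1} = 0} x^λ`. -/
def PCr (r : ℕ) : MvPowerSeries (Fin r) ℤ := genFun (concaveVectors r)

/-- The substitution `f ↦ f(x₁, …, x_r, 0, 0, …)`. -/
def restrictVars (r : ℕ) : MvPowerSeries ℕ ℤ →ₐ[ℤ] MvPowerSeries (Fin r) ℤ :=
  MvPowerSeries.killCompl Fin.valEmbedding

/-- The denominator `∏_{i=1}^r (1 - ∏_{j=1}^i x_j^{1+i-j})` (indices shifted by one). -/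
def denom (r : ℕ) : MvPolynomial (Fin r) ℤ :=
  ∏ i : Fin r, (1 - ∏ j ∈ Finset.Iic i, MvPolynomial.X j ^ (1 + (i : ℕ) - (j : ℕ)))

/-- The factor `1 - ∏_{j=1}^i x_j^{1+i-j}` of the infinite denominator (indices shifted by one). -/
def denomFactor (i : ℕ) : MvPowerSeries ℕ ℤ :=
  1 - ∏ j ∈ Finset.Iic i, MvPowerSeries.X j ^ (1 + i - j)

/-- The substitution `q ↦ q(x₁, …, x_r, 0)` on polynomials in `r + 1` variables. -/
def setLastZero (r : ℕ) : MvPolynomial (Fin (r + 1)) ℤ →ₐ[ℤ] MvPolynomial (Fin r) ℤ :=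
  MvPolynomial.aeval
    (Fin.snoc (α := fun _ => MvPolynomial (Fin r) ℤ) (fun i : Fin r => MvPolynomial.X i) 0)

/-- A polynomial in `x₁, …, x_r`, regarded as a power series in `x₁, x₂, …`. -/
def toSeries {r : ℕ} (q : MvPolynomial (Fin r) ℤ) : MvPowerSeries ℕ ℤ :=
  ((MvPolynomial.rename Fin.val q : MvPolynomial ℕ ℤ) : MvPowerSeries ℕ ℤ)

/-- The two descriptions of `PC_r` agree: `PC_r(x₁, …, x_r) = PC(x₁, …, x_r, 0, 0, …)`. -/
theorem restrictVars_PC (r : ℕ) : restrictVars r PC = PCr r := by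
  funext m
  have h : (restrictVars r PC) m = PC (m.embDomain Fin.valEmbedding) := rfl
  rw [h]
  suffices hiff : IsConcave (m.embDomain Fin.valEmbedding) ↔
      ∃ l : ℕ →₀ ℕ, IsConcave l ∧ l r = 0 ∧ ∀ i : Fin r, l i = m i by
    classical
    unfold PC PCr genFun concaveVectors
    exact if_congr hiff rfl rfl
  constructor
  · intro hc
    refine ⟨_, hc, ?_, ?_⟩
    · apply Finsupp.embDomain_of_notMem_range
      rintro ⟨i, hi⟩
      exact (Nat.ne_of_lt i.2) hi
    · intro i
      exact Finsupp.embDomain_apply_self Fin.valEmbedding m i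
  · rintro ⟨l, hl, h0, hm⟩
    suffices he : m.embDomain Fin.valEmbedding = l by rwa [he]
    ext j
    by_cases hj : j < r
    · rw [show j = Fin.valEmbedding (⟨j, hj⟩ : Fin r) from rfl, Finsupp.embDomain_apply_self]
      exact (hm ⟨j, hj⟩).symm
    · rw [Finsupp.embDomain_of_notMem_range]
      · have := hl.1 (not_lt.mp hj)
        omega
      · rintro ⟨i, hi⟩
        exact hj (hi ▸ i.2)

end

end ConcavePartition

namespace ConcavePartition

/-! ### Generating functions of unions of cones. -/

section Cone

variable {σ ι : Type*}

/-! In `r` variables, the second differences `secondDiff r` embed exponent vectors in `ℤ^r` and send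
the hooks `(i, …, 1, 0, …)`, the exponents in the denominator, to the standard basis. Concave
vectors stay concave when a hook is added (`IsConcave.add_hook`), and their second differences are
at least `-1` (`IsConcave.two_mul_le`). By Dickson's lemma they form a finite union of cones `{m | D
p ≤ D m}`.

Such a cone is `p` plus the free monoid on the hooks, so its generating function times the
denominator is `x^p`. Cones intersect in cones, so inclusion–exclusion gives an integer polynomial
numerator whose value at `1` is `1` and whose exponents are themselves concave, hence weakly
decreasing.

For infinitely many variables, `Q` is `PC` times the infinite product. Setting the variables beyond
`r` to zero is a continuous ring homomorphism, so `Q` restricts to `Q_r`; this also makes the `Q_r`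
compatible. -/

theorem coeff_genFun (S : Set (σ →₀ ℕ)) (m : σ →₀ ℕ) [Decidable (m ∈ S)] :
    MvPowerSeries.coeff m (genFun S) = if m ∈ S then 1 else 0 := by
  rw [show MvPowerSeries.coeff m (genFun S) = genFun S m from rfl, genFun]
  congr

/-- The exponent vectors whose coordinates `D` dominate those of `p`, with equality on `s`. -/
def face (D : (σ →₀ ℕ) →+ (ι → ℤ)) (p : σ →₀ ℕ) (s : Finset ι) : Set (σ →₀ ℕ) :=
  {m | D p ≤ D m ∧ ∀ i ∈ s, D m i = D p i}

variable [Fintype ι] [DecidableEq ι] {D : (σ →₀ ℕ) →+ (ι → ℤ)} {v : ι → (σ →₀ ℕ)}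

theorem eq_add_sum_of_le (hv : ∀ i, D (v i) = Pi.single i 1) (hD : Function.Injective D)
    {p m : σ →₀ ℕ} (h : D p ≤ D m) : m = p + ∑ i, (D m i - D p i).toNat • v i := by
  apply hD
  funext j
  have hj : D p j ≤ D m j := h j
  simp only [map_add, map_sum, map_nsmul, hv, Pi.add_apply, Finset.sum_apply, Pi.smul_apply,
    Pi.single_apply, smul_ite, nsmul_zero, Finset.sum_ite_eq, Finset.mem_univ, if_true]
  simp only [nsmul_eq_mul, mul_one]
  omega

/-- Translating a face by `v a` yields its points with `D m a > D p a`; subtracting them leaves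
equality at `a`. Each denominator factor thus pins one coordinate, until only `p` remains. -/
theorem genFun_face_mul (hv : ∀ i, D (v i) = Pi.single i 1) (hD : Function.Injective D)
    (p : σ →₀ ℕ) {s : Finset ι} {a : ι} (ha : a ∉ s) :
    genFun (face D p s) * (1 - MvPowerSeries.monomial (v a) 1) =
      genFun (face D p (insert a s)) := by
  classical
  ext m
  rw [mul_sub, mul_one, map_sub, MvPowerSeries.coeff_mul_monomial, mul_one]
  have key : ∀ n, m = n + v a → (n ∈ face D p s ↔ m ∈ face D p s ∧ D m a ≠ D p a) := by
    rintro n rfl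
    simp only [face, Set.mem_ofPred_eq, map_add, hv, Pi.le_def, Pi.add_apply, Pi.single_apply]
    constructor
    · rintro ⟨h1, h2⟩
      refine ⟨⟨fun i => ?_, fun i hi => ?_⟩, ?_⟩
      · have := h1 i
        split_ifs <;> omega
      · rw [if_neg (ne_of_mem_of_not_mem hi ha), add_zero, h2 i hi]
      · have := h1 a
        simp only [if_true]
        omega
    · rintro ⟨⟨h1, h2⟩, h3⟩
      refine ⟨fun i => ?_, fun i hi => ?_⟩
      · have := h1 i
        split_ifs at this with h
        · subst h
          simp only [if_true] at h3
          omega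
        · omega
      · have := h2 i hi
        rwa [if_neg (ne_of_mem_of_not_mem hi ha), add_zero] at this
  have hins : m ∈ face D p (insert a s) ↔ m ∈ face D p s ∧ D m a = D p a := by
    simp only [face, Set.mem_ofPred_eq, Finset.forall_mem_insert]
    tauto
  by_cases hle : v a ≤ m
  · rw [if_pos hle]
    have hk := key _ (tsub_add_cancel_of_le hle).symm
    simp only [coeff_genFun, hk, hins]
    by_cases h1 : m ∈ face D p s <;> by_cases h2 : D m a = D p a <;> simp [h1, h2]
  -- No term is subtracted here: a point of the face with `D m a > D p a` would dominate `v a`.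
  · rw [if_neg hle, sub_zero]
    simp only [coeff_genFun, hins]
    by_cases h1 : m ∈ face D p s
    · have h2 : D m a = D p a := by
        by_contra h2
        have h3 : D p a ≤ D m a := h1.1 a
        apply hle
        rw [eq_add_sum_of_le hv hD h1.1]
        refine le_add_left (le_trans ?_ (Finset.single_le_sum
          (f := fun i => (D m i - D p i).toNat • v i) (fun i _ => zero_le) (Finset.mem_univ a)))
        calc v a = 1 • v a := (one_nsmul _).symm
          _ ≤ _ := nsmul_le_nsmul_left zero_le (by omega)
      simp [h1, h2]
    · simp [h1]

theorem genFun_cone_mul (hv : ∀ i, D (v i) = Pi.single i 1) (hD : Function.Injective D)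
    (p : σ →₀ ℕ) :
    genFun {m | D p ≤ D m} * ∏ i, (1 - MvPowerSeries.monomial (v i) 1) =
      MvPowerSeries.monomial p 1 := by
  classical
  have h : ∀ s : Finset ι, genFun {m | D p ≤ D m} *
      ∏ i ∈ s, (1 - MvPowerSeries.monomial (v i) 1) = genFun (face D p s) := by
    intro s
    induction s using Finset.induction_on with
    | empty => simp [face]
    | insert a s ha ih =>
      rw [Finset.prod_insert ha, mul_comm (1 - _), ← mul_assoc, ih, genFun_face_mul hv hD p ha]
  rw [h]
  ext m
  rw [coeff_genFun, MvPowerSeries.coeff_monomial]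
  congr 1
  refine propext ⟨fun hm => hD (funext fun i => hm.2 i (Finset.mem_univ i)), ?_⟩
  rintro rfl
  exact ⟨le_rfl, fun _ _ => rfl⟩

theorem genFun_union (A B : Set (σ →₀ ℕ)) :
    genFun (A ∪ B) = genFun A + genFun B - genFun (A ∩ B) := by
  classical
  ext m
  simp only [map_sub, map_add, coeff_genFun, Set.mem_union, Set.mem_inter_iff]
  by_cases h1 : m ∈ A <;> by_cases h2 : m ∈ B <;> simp [h1, h2]

/-- The new apex has `D t` equal to the coordinatewise maximum of `D p` and `D q`. -/
theorem exists_cone_inter (hv : ∀ i, D (v i) = Pi.single i 1) (p q : σ →₀ ℕ) :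
    ∃ t, {m | D p ≤ D m} ∩ {m | D q ≤ D m} = {m | D t ≤ D m} := by
  refine ⟨p + ∑ i, (D q i - D p i).toNat • v i, ?_⟩
  have h : ∀ j, D (p + ∑ i, (D q i - D p i).toNat • v i) j = max (D p j) (D q j) := by
    intro j
    simp only [map_add, map_sum, map_nsmul, hv, Pi.add_apply, Finset.sum_apply, Pi.smul_apply,
      Pi.single_apply, smul_ite, nsmul_zero, Finset.sum_ite_eq, Finset.mem_univ, if_true]
    simp only [nsmul_eq_mul, mul_one]
    omega
  ext m
  simp only [Set.mem_inter_iff, Set.mem_ofPred_eq, Pi.le_def, h, max_le_iff, forall_and]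

theorem exists_numerator_of_iUnion_cone (hv : ∀ i, D (v i) = Pi.single i 1)
    (hD : Function.Injective D) (n : ℕ) (p : Fin (n + 1) → (σ →₀ ℕ)) :
    ∃ q : MvPolynomial σ ℤ,
      genFun (⋃ k, {m | D (p k) ≤ D m}) * ∏ i, (1 - MvPowerSeries.monomial (v i) 1) =
        (q : MvPowerSeries σ ℤ) ∧
      MvPolynomial.eval (fun _ => (1 : ℤ)) q = 1 ∧
      ∀ m ∈ q.support, m ∈ ⋃ k, {m | D (p k) ≤ D m} := by
  classical
  have base : ∀ t : σ →₀ ℕ, ∃ q : MvPolynomial σ ℤ,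
      genFun {m | D t ≤ D m} * ∏ i, (1 - MvPowerSeries.monomial (v i) 1) =
        (q : MvPowerSeries σ ℤ) ∧
      MvPolynomial.eval (fun _ => (1 : ℤ)) q = 1 ∧ ∀ m ∈ q.support, m ∈ {m | D t ≤ D m} := by
    intro t
    refine ⟨MvPolynomial.monomial t 1, ?_, ?_, fun m hm => ?_⟩
    · rw [genFun_cone_mul hv hD, MvPolynomial.coe_monomial]
    · rw [MvPolynomial.eval_monomial]
      simp [Finsupp.prod]
    · have := MvPolynomial.support_monomial_subset hm
      rw [Finset.mem_singleton.mp this]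
      exact le_refl (D t)
  induction n with
  | zero =>
    have : (⋃ k, {m | D (p k) ≤ D m}) = {m | D (p 0) ≤ D m} := by
      ext m; simp [Fin.exists_fin_one]
    rw [this]
    exact base _
  | succ n ih =>
    obtain ⟨q₁, h₁, e₁, s₁⟩ := ih (fun k => p k.castSucc)
    obtain ⟨q₂, h₂, e₂, s₂⟩ := base (p (Fin.last _))
    choose t ht using fun k : Fin (n + 1) => exists_cone_inter hv (p k.castSucc) (p (Fin.last _))
    obtain ⟨q₃, h₃, e₃, s₃⟩ := ih t
    have hU : (⋃ k, {m | D (p k) ≤ D m}) =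
        (⋃ k : Fin (n + 1), {m | D (p k.castSucc) ≤ D m}) ∪ {m | D (p (Fin.last _)) ≤ D m} := by
      ext m
      simp [Fin.exists_fin_succ']
    have hI : (⋃ k, {m | D (t k) ≤ D m}) =
        (⋃ k : Fin (n + 1), {m | D (p k.castSucc) ≤ D m}) ∩ {m | D (p (Fin.last _)) ≤ D m} := by
      simp only [← ht, Set.iUnion_inter]
    rw [hI] at h₃ s₃
    -- Inclusion–exclusion; the value at `1` is `1 + 1 - 1`, which is why the union must be
    -- nonempty.
    refine ⟨q₁ + q₂ - q₃, ?_, by simp [e₁, e₂, e₃], fun m hm => ?_⟩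
    · rw [hU, genFun_union, sub_mul, add_mul, h₁, h₂, h₃]
      ext m
      simp [MvPolynomial.coeff_coe]
    · rw [hU]
      rcases Finset.mem_union.mp (MvPolynomial.support_sub _ _ _ hm) with h | h
      · rcases Finset.mem_union.mp (MvPolynomial.support_add h) with h | h
        · exact Or.inl (s₁ m h)
        · exact Or.inr (s₂ m h)
      · exact Or.inl (s₃ m h).1

theorem exists_iUnion_cone (hv : ∀ i, D (v i) = Pi.single i 1) (hD : Function.Injective D)
    {S : Set (σ →₀ ℕ)} (hne : S.Nonempty) (hadd : ∀ m ∈ S, ∀ i, m + v i ∈ S)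
    (hbdd : ∀ m ∈ S, ∀ i, -1 ≤ D m i) :
    ∃ (n : ℕ) (p : Fin (n + 1) → (σ →₀ ℕ)), S = ⋃ k, {m | D (p k) ≤ D m} := by
  classical
  -- The shift by one moves `S` into `ℕ^ι`, where Dickson's lemma applies: minimal elements are
  -- finite in number.
  let e : (σ →₀ ℕ) → ι → ℕ := fun m i => (D m i + 1).toNat
  have he : ∀ m ∈ S, ∀ p ∈ S, e p ≤ e m → D p ≤ D m := by
    intro m hm p hp h i
    have h1 : (D p i + 1).toNat ≤ (D m i + 1).toNat := h i
    have h2 := hbdd m hm i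
    have h3 := hbdd p hp i
    show D p i ≤ D m i
    omega
  have hpwo : (e '' S).IsPWO := Set.isPWO_of_wellQuasiOrderedLE _
  have hfin : {x | Minimal (· ∈ e '' S) x}.Finite :=
    WellQuasiOrderedLE.finite_of_isAntichain (setOfPred_minimal_antichain _)
  have : Finite {x | Minimal (· ∈ e '' S) x} := hfin
  obtain ⟨n, ⟨f⟩⟩ := Finite.exists_equiv_fin {x | Minimal (· ∈ e '' S) x}
  have hmin : ∀ m ∈ S, ∃ k : Fin n, (f.symm k : ι → ℕ) ≤ e m := by
    intro m hm
    obtain ⟨x, hx, hx'⟩ := hpwo.exists_le_minimal (Set.mem_image_of_mem e hm)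
    exact ⟨f ⟨x, hx'⟩, by simpa using hx⟩
  choose p hpS hp using fun k : Fin n => (f.symm k).2.1
  obtain ⟨m₀, hm₀⟩ := hne
  obtain ⟨k₀, -⟩ := hmin m₀ hm₀
  obtain ⟨n, rfl⟩ : ∃ l, n = l + 1 := Nat.exists_eq_succ_of_ne_zero (by have := k₀.2; omega)
  refine ⟨n, p, Set.ext fun m => ?_⟩
  simp only [Set.mem_iUnion, Set.mem_ofPred_eq]
  constructor
  · intro hm
    obtain ⟨k, hk⟩ := hmin m hm
    exact ⟨k, he m hm _ (hpS k) ((hp k).le.trans hk)⟩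
  · rintro ⟨k, hk⟩
    have hnsmul : ∀ i (c : ℕ), ∀ m ∈ S, m + c • v i ∈ S := by
      intro i c
      induction c with
      | zero => simp
      | succ c ih =>
        intro m hm
        rw [succ_nsmul, ← add_assoc]
        exact hadd _ (ih m hm) i
    have hsum : ∀ (c : ι → ℕ) (s : Finset ι), ∀ m ∈ S, m + ∑ i ∈ s, c i • v i ∈ S := by
      intro c s
      induction s using Finset.induction_on with
      | empty => simp
      | insert a s ha ih =>
        intro m hm
        rw [Finset.sum_insert ha, ← add_assoc]
        exact ih _ (hnsmul _ _ _ hm)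
    rw [eq_add_sum_of_le hv hD hk]
    exact hsum _ _ _ (hpS k)

theorem exists_numerator (hv : ∀ i, D (v i) = Pi.single i 1) (hD : Function.Injective D)
    {S : Set (σ →₀ ℕ)} (hne : S.Nonempty) (hadd : ∀ m ∈ S, ∀ i, m + v i ∈ S)
    (hbdd : ∀ m ∈ S, ∀ i, -1 ≤ D m i) :
    ∃ q : MvPolynomial σ ℤ,
      genFun S * ∏ i, (1 - MvPowerSeries.monomial (v i) 1) = (q : MvPowerSeries σ ℤ) ∧
      MvPolynomial.eval (fun _ => (1 : ℤ)) q = 1 ∧ ∀ m ∈ q.support, m ∈ S := by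
  obtain ⟨n, p, rfl⟩ := exists_iUnion_cone hv hD hne hadd hbdd
  exact exists_numerator_of_iUnion_cone hv hD n p

end Cone

/-! ### Concave partitions and their second differences. -/

theorem IsConcave.add_hook {l l' : ℕ →₀ ℕ} (hl : IsConcave l) (n : ℕ)
    (h : ∀ j, l' j = l j + (n - j)) : IsConcave l' := by
  refine ⟨fun i j hij => ?_, Set.Subset.antisymm ?_ ?_⟩
  · have := hl.1 hij
    rw [h, h]
    omega
  · rintro ⟨x, y⟩ ⟨k, hk, s, hs, hsum⟩
    have hs' : ∀ i, l (s i).2 + (n - (s i).2) ≤ (s i).1 := fun i => by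
      have : ¬ (s i).1 < l' (s i).2 := hs i
      rw [h] at this
      omega
    have h1 : ∑ i, (s i).1 = k * x := by
      simpa [Prod.fst_sum] using congrArg Prod.fst hsum
    have h2 : ∑ i, (s i).2 = k * y := by
      simpa [Prod.snd_sum] using congrArg Prod.snd hsum
    -- Jensen's inequality for the convex function `y ↦ max (n - y) 0`.
    have hJ : k * (n - y) ≤ ∑ i, (n - (s i).2) := by
      have : k * n ≤ ∑ i, (n - (s i).2) + ∑ i, (s i).2 := by
        rw [← Finset.sum_add_distrib]
        calc k * n = ∑ _i : Fin k, n := by simp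
          _ ≤ _ := Finset.sum_le_sum fun i _ => by omega
      rw [h2] at this
      rw [Nat.mul_sub]
      omega
    have hsub : ∑ i, ((s i).1 - (n - (s i).2)) + ∑ i, (n - (s i).2) = k * x := by
      rw [← Finset.sum_add_distrib, ← h1]
      exact Finset.sum_congr rfl fun i _ => by have := hs' i; omega
    have hxy : n - y ≤ x := Nat.le_of_mul_le_mul_left (by omega) hk
    -- With the hook removed, the points may sum to too little; adding the deficit `d` to one first
    -- coordinate keeps it in the ideal.
    obtain ⟨d, hd⟩ : ∃ d, ∑ i, ((s i).1 - (n - (s i).2)) + d = k * (x - (n - y)) := by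
      refine Nat.exists_eq_add_of_le (?_ : _ ≤ _) |>.imp fun _ h => h.symm
      rw [Nat.mul_sub]
      omega
    have hmem : (x - (n - y), y) ∈ intClosure (monoidIdeal l) := by
      refine ⟨k, hk, fun i => ((s i).1 - (n - (s i).2) + if i = ⟨0, hk⟩ then d else 0, (s i).2),
        fun i hi => ?_, ?_⟩
      · have h3 : (s i).1 - (n - (s i).2) + (if i = ⟨0, hk⟩ then d else 0) < l (s i).2 := hi
        have := hs' i
        omega
      · ext
        · simp [Prod.fst_sum, Finset.sum_add_distrib, hd]
        · simp [Prod.snd_sum, h2]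
    rw [hl.2] at hmem
    have h4 : ¬ x - (n - y) < l y := hmem
    show ¬ x < l' y
    rw [h]
    omega
  · intro a ha
    exact ⟨1, one_pos, fun _ => a, fun _ => ha, by simp⟩

theorem IsConcave.two_mul_le {l : ℕ →₀ ℕ} (hl : IsConcave l) (a : ℕ) :
    2 * l (a + 1) ≤ l a + l (a + 2) + 1 := by
  by_contra! hlt
  have h1 := hl.1 (Nat.le_add_right a 1)
  have hmem : (l (a + 1) - 1, a + 1) ∈ intClosure (monoidIdeal l) := by
    -- If the bound fails, `(l (a + 1) - 1, a + 1)`, outside the ideal, is the midpoint of these two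
    -- points of the ideal.
    refine ⟨2, two_pos, ![(l a, a), (2 * (l (a + 1) - 1) - l a, a + 2)], fun i hi => ?_, ?_⟩
    · fin_cases i
      · exact lt_irrefl (l a) hi
      · have h2 : 2 * (l (a + 1) - 1) - l a < l (a + 2) := hi
        omega
    · ext
      · simp
        omega
      · simp
        omega
  rw [hl.2] at hmem
  have h2 : ¬ l (a + 1) - 1 < l (a + 1) := hmem
  omega

theorem isConcave_zero : IsConcave 0 := by
  have h : monoidIdeal 0 = Set.univ := by
    ext p
    simp [monoidIdeal, ferrers]
  refine ⟨fun _ _ _ => le_rfl, ?_⟩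
  rw [h]
  exact Set.eq_univ_of_forall fun a => ⟨1, one_pos, fun _ => a, fun _ => Set.mem_univ _, by simp⟩

theorem mem_concaveVectors {r : ℕ} {m : Fin r →₀ ℕ} :
    m ∈ concaveVectors r ↔ IsConcave (m.embDomain Fin.valEmbedding) := by
  classical
  have h : restrictVars r PC m = PCr r m := congrFun (restrictVars_PC r) m
  have h' : restrictVars r PC m = PC (m.embDomain Fin.valEmbedding) := rfl
  rw [h', PC, PCr, genFun, genFun] at h
  simp only [Set.mem_ofPred_eq] at h
  by_cases h1 : m ∈ concaveVectors r <;>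
    by_cases h2 : IsConcave (m.embDomain Fin.valEmbedding) <;> simp_all

/-- The exponent vector `(i + 1, i, …, 1, 0, …, 0)`. -/
noncomputable def hook {r : ℕ} (i : Fin r) : Fin r →₀ ℕ :=
  Finsupp.equivFunOnFinite.symm fun j => 1 + (i : ℕ) - j

theorem embDomain_apply {r : ℕ} (m : Fin r →₀ ℕ) (j : ℕ) :
    m.embDomain Fin.valEmbedding j = if h : j < r then m ⟨j, h⟩ else 0 := by
  split_ifs with h
  · exact Finsupp.embDomain_apply_self Fin.valEmbedding m ⟨j, h⟩
  · apply Finsupp.embDomain_of_notMem_range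
    rintro ⟨i, hi⟩
    exact h (hi ▸ i.2)

theorem embDomain_hook {r : ℕ} (i : Fin r) (j : ℕ) :
    (hook i).embDomain Fin.valEmbedding j = 1 + (i : ℕ) - j := by
  rw [embDomain_apply]
  split_ifs with h
  · rfl
  · have := i.2
    omega

/-- The second differences of an exponent vector, extended by zero. -/
noncomputable def secondDiff (r : ℕ) : (Fin r →₀ ℕ) →+ (Fin r → ℤ) where
  toFun m i := (m.embDomain Fin.valEmbedding i : ℤ) - 2 * m.embDomain Fin.valEmbedding (i + 1) +
    m.embDomain Fin.valEmbedding (i + 2)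
  map_zero' := by
    ext i
    simp
  map_add' m n := by
    ext i
    simp only [Finsupp.embDomain_add, Finsupp.add_apply, Pi.add_apply]
    push_cast
    ring

theorem secondDiff_apply {r : ℕ} (m : Fin r →₀ ℕ) (i : Fin r) :
    secondDiff r m i = (m.embDomain Fin.valEmbedding i : ℤ) -
      2 * m.embDomain Fin.valEmbedding (i + 1) + m.embDomain Fin.valEmbedding (i + 2) := rfl

/-- The truncated function `j ↦ 1 + i - j` is piecewise linear with a single kink, at `j = i + 1`.
-/
theorem secondDiff_hook {r : ℕ} (i : Fin r) : secondDiff r (hook i) = Pi.single i 1 := by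
  ext j
  rw [secondDiff_apply, embDomain_hook, embDomain_hook, embDomain_hook, Pi.single_apply]
  split_ifs with h
  · subst h
    omega
  · have : (j : ℕ) ≠ i := fun h' => h (Fin.ext h')
    omega

theorem secondDiff_injective (r : ℕ) : Function.Injective (secondDiff r) := by
  intro m n h
  -- Downward induction on `j`: both vectors vanish from `r` on, and the second difference at `j`
  -- recovers entry `j` from the next two.
  have key : ∀ k j, r ≤ j + k →
      m.embDomain Fin.valEmbedding j = n.embDomain Fin.valEmbedding j := by
    intro k
    induction k with
    | zero =>
      intro j hj
      rw [embDomain_apply, embDomain_apply, dif_neg (by omega), dif_neg (by omega)]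
    | succ k ih =>
      intro j hj
      by_cases hjr : j < r
      · have h1 := ih (j + 1) (by omega)
        have h2 := ih (j + 2) (by omega)
        have h3 := congrFun h ⟨j, hjr⟩
        rw [secondDiff_apply, secondDiff_apply] at h3
        simp only [h1, h2] at h3
        omega
      · rw [embDomain_apply, embDomain_apply, dif_neg hjr, dif_neg hjr]
  apply Finsupp.embDomain_injective Fin.valEmbedding
  ext j
  exact key r j (by omega)

theorem coe_denom (r : ℕ) : (denom r : MvPowerSeries (Fin r) ℤ) =
    ∏ i, (1 - MvPowerSeries.monomial (hook i) 1) := by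
  have h : ∀ q : MvPolynomial (Fin r) ℤ, (q : MvPowerSeries (Fin r) ℤ) =
    MvPolynomial.coeToMvPowerSeries.ringHom q := fun _ => rfl
  rw [denom, h, map_prod]
  refine Finset.prod_congr rfl fun i _ => ?_
  rw [map_sub, map_one, map_prod]
  simp only [← h, MvPolynomial.coe_pow, MvPolynomial.coe_X, MvPowerSeries.X_pow_eq]
  rw [MvPowerSeries.prod_monomial, Finset.prod_const_one]
  congr 3
  ext j
  simp only [Finsupp.finsetSum_apply, Finsupp.single_apply, Finset.sum_ite_eq', Finset.mem_Iic]
  show _ = 1 + (i : ℕ) - j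
  split_ifs with hji
  · rfl
  · have : (i : ℕ) < j := Fin.not_le.mp hji
    omega

theorem exists_polynomial_numerator (r : ℕ) : ∃ q : MvPolynomial (Fin r) ℤ,
    PCr r * (denom r : MvPowerSeries (Fin r) ℤ) = (q : MvPowerSeries (Fin r) ℤ) ∧
      MvPolynomial.eval (fun _ => (1 : ℤ)) q = 1 ∧ ∀ m ∈ q.support, Antitone m := by
  obtain ⟨q, h1, h2, h3⟩ := exists_numerator (D := secondDiff r) (v := hook)
    (S := concaveVectors r) secondDiff_hook (secondDiff_injective r)
    ⟨0, mem_concaveVectors.mpr (by simpa using isConcave_zero)⟩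
    (fun m hm i => by
      rw [mem_concaveVectors] at hm ⊢
      refine hm.add_hook (1 + i) fun j => ?_
      rw [Finsupp.embDomain_add, Finsupp.add_apply, embDomain_hook])
    (fun m hm i => by
      have := (mem_concaveVectors.mp hm).two_mul_le i
      rw [secondDiff_apply]
      omega)
  refine ⟨q, by rw [coe_denom, ← h1, PCr], h2, fun m hm i j hij => ?_⟩
  have := (mem_concaveVectors.mp (h3 m hm)).1 (show (i : ℕ) ≤ j from hij)
  simpa [embDomain_apply] using this

/-! ### The infinite product and its restrictions. -/

theorem coeff_restrictVars (r : ℕ) (f : MvPowerSeries ℕ ℤ) (m : Fin r →₀ ℕ) :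
    MvPowerSeries.coeff m (restrictVars r f) =
      MvPowerSeries.coeff (m.embDomain Fin.valEmbedding) f := rfl

theorem continuous_restrictVars (r : ℕ) : Continuous (restrictVars r) :=
  continuous_pi fun m => continuous_apply (m.embDomain Fin.valEmbedding)

theorem prod_X_pow_eq_monomial (i : ℕ) :
    ∏ j ∈ Finset.Iic i, (MvPowerSeries.X j : MvPowerSeries ℕ ℤ) ^ (1 + i - j) =
      MvPowerSeries.monomial (∑ j ∈ Finset.Iic i, Finsupp.single j (1 + i - j)) 1 := by
  simp only [MvPowerSeries.X_pow_eq]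
  rw [MvPowerSeries.prod_monomial, Finset.prod_const_one]

theorem multipliable_denomFactor : Multipliable denomFactor := by
  have h : denomFactor = fun i => 1 + -∏ j ∈ Finset.Iic i,
      (MvPowerSeries.X j : MvPowerSeries ℕ ℤ) ^ (1 + i - j) := by
    funext i
    rw [denomFactor, sub_eq_add_neg]
  rw [h]
  apply MvPowerSeries.WithPiTopology.multipliable_one_add_of_tendsto_order_atTop_nhds_top
  rw [ENat.tendsto_nhds_top_iff_natCast_lt]
  intro n
  filter_upwards [Filter.eventually_ge_atTop n] with i hi
  rw [MvPowerSeries.order_neg, prod_X_pow_eq_monomial]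
  refine lt_of_lt_of_le (Nat.cast_lt.mpr (Nat.lt_succ_of_le hi)) (MvPowerSeries.le_order fun d hd => ?_)
  refine MvPowerSeries.coeff_monomial_ne ?_ _
  rintro rfl
  have h1 : (Finsupp.degree (∑ j ∈ Finset.Iic i, Finsupp.single j (1 + i - j)) : ℕ) < i + 1 := by
    exact_mod_cast hd
  rw [map_sum] at h1
  -- The power `x₁^(i + 1)` alone gives the monomial degree at least `i + 1`.
  have h2 := Finset.single_le_sum (s := Finset.Iic i)
    (f := fun j => Finsupp.degree (Finsupp.single j (1 + i - j))) (fun _ _ => zero_le)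
    (Finset.mem_Iic.mpr (zero_le (a := i)))
  simp only [Finsupp.degree_single] at h1 h2
  omega

theorem restrictVars_denomFactor_of_le {r i : ℕ} (h : r ≤ i) :
    restrictVars r (denomFactor i) = 1 := by
  rw [denomFactor, map_sub, map_one, map_prod, sub_eq_self]
  refine Finset.prod_eq_zero (Finset.mem_Iic.mpr le_rfl) ?_
  rw [map_pow, restrictVars, MvPowerSeries.killCompl_X_eq_zero, zero_pow (by omega)]
  rintro ⟨j, hj⟩
  have : (j : ℕ) = i := hj
  omega

theorem restrictVars_denomFactor {r : ℕ} (i : Fin r) :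
    restrictVars r (denomFactor i) = 1 - MvPowerSeries.monomial (hook i) 1 := by
  rw [denomFactor, map_sub, map_one, prod_X_pow_eq_monomial]
  congr 1
  rw [← MvPowerSeries.killCompl_monomial_embDomain (e := Fin.valEmbedding), restrictVars]
  suffices h : ∑ j ∈ Finset.Iic (i : ℕ), Finsupp.single j (1 + (i : ℕ) - j) =
      (hook i).embDomain Fin.valEmbedding by rw [h]
  ext j
  rw [embDomain_hook]
  simp only [Finsupp.finsetSum_apply, Finsupp.single_apply, Finset.sum_ite_eq', Finset.mem_Iic]
  split_ifs <;> omega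

theorem restrictVars_tprod_denomFactor (r : ℕ) :
    restrictVars r (∏' i, denomFactor i) = (denom r : MvPowerSeries (Fin r) ℤ) := by
  have h := multipliable_denomFactor.hasProd.map (restrictVars r) (continuous_restrictVars r)
  have h' : HasProd (restrictVars r ∘ denomFactor)
      (∏ i ∈ Finset.range r, restrictVars r (denomFactor i)) :=
    hasProd_prod_of_ne_finset_one fun i hi =>
      restrictVars_denomFactor_of_le (by simpa using hi)
  rw [h.unique h', coe_denom, Finset.prod_range]
  exact Finset.prod_congr rfl fun i _ => restrictVars_denomFactor i

theorem isUnit_coe_denom (r : ℕ) : IsUnit (denom r : MvPowerSeries (Fin r) ℤ) := by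
  rw [MvPowerSeries.isUnit_iff_constantCoeff, coe_denom, map_prod]
  refine isUnit_iff_exists_inv.mpr ⟨1, ?_⟩
  rw [mul_one]
  refine Finset.prod_eq_one fun i _ => ?_
  rw [map_sub, map_one, ← MvPowerSeries.coeff_zero_eq_constantCoeff_apply,
    MvPowerSeries.coeff_monomial_ne, sub_zero]
  intro h
  have := DFunLike.congr_fun h i
  have h' : (0 : ℕ) = 1 + (i : ℕ) - i := this
  omega

theorem isUnit_tprod_denomFactor : IsUnit (∏' i, denomFactor i) := by
  -- Invertibility depends only on the constant term, which survives restriction to zero variables.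
  have h := isUnit_coe_denom 0
  rw [← restrictVars_tprod_denomFactor] at h
  rw [MvPowerSeries.isUnit_iff_constantCoeff] at h ⊢
  rw [← MvPowerSeries.coeff_zero_eq_constantCoeff_apply, coeff_restrictVars] at h
  simpa using h

/-! ### Compatibility of the numerators and the telescoping sum. -/

theorem coeff_setLastZero {r : ℕ} (q : MvPolynomial (Fin (r + 1)) ℤ) (m : Fin r →₀ ℕ) :
    (setLastZero r q).coeff m = q.coeff (m.embDomain Fin.castSuccEmb) := by
  have h : MvPolynomial.coeToMvPowerSeries.ringHom.comp (setLastZero r).toRingHom =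
      ((MvPowerSeries.killCompl Fin.castSuccEmb).toRingHom.comp
        MvPolynomial.coeToMvPowerSeries.ringHom :
          MvPolynomial (Fin (r + 1)) ℤ →+* MvPowerSeries (Fin r) ℤ) := by
    refine MvPolynomial.ringHom_ext (fun c => by simp) fun i => ?_
    simp only [RingHom.comp_apply, AlgHom.toRingHom_eq_coe, RingHom.coe_coe, setLastZero,
      MvPolynomial.aeval_X, MvPolynomial.coeToMvPowerSeries.ringHom_apply, MvPolynomial.coe_X]
    induction i using Fin.lastCases with
    | last =>
      rw [Fin.snoc_last, MvPowerSeries.killCompl_X_eq_zero, MvPolynomial.coe_zero]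
      rintro ⟨j, hj⟩
      exact Fin.castSucc_ne_last j hj
    | cast j =>
      rw [Fin.snoc_castSucc, MvPolynomial.coe_X]
      exact (MvPowerSeries.killCompl_X (e := Fin.castSuccEmb) j).symm
  exact congrArg (MvPowerSeries.coeff m) (RingHom.congr_fun h q)

theorem embDomain_castSucc {r : ℕ} (m : Fin r →₀ ℕ) :
    (m.embDomain Fin.castSuccEmb).embDomain Fin.valEmbedding =
      m.embDomain Fin.valEmbedding := by
  simp only [Finsupp.embDomain_eq_mapDomain, ← Finsupp.mapDomain_comp]
  rfl

/-- If `q` is a restriction of `f`, then `toSeries q` is `f` truncated to monomials in the first `r`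
variables, so each coefficient of the telescoping sum stabilises. -/
theorem coeff_toSeries {r : ℕ} (q : MvPolynomial (Fin r) ℤ) {f : MvPowerSeries ℕ ℤ}
    (h : restrictVars r f = (q : MvPowerSeries (Fin r) ℤ)) (d : ℕ →₀ ℕ)
    [Decidable (∀ i ∈ d.support, i < r)] :
    MvPowerSeries.coeff d (toSeries q) =
      if ∀ i ∈ d.support, i < r then MvPowerSeries.coeff d f else 0 := by
  rw [toSeries, MvPolynomial.coeff_coe]
  split_ifs with hd
  · obtain ⟨m, rfl⟩ : d ∈ Set.range (Finsupp.embDomain (Fin.valEmbedding (n := r))) := by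
      rw [Finsupp.mem_range_embDomain_iff]
      exact fun i hi => ⟨⟨i, hd i hi⟩, rfl⟩
    rw [← coeff_restrictVars, h, MvPolynomial.coeff_coe]
    exact MvPolynomial.coeff_rename_embDomain Fin.valEmbedding q m
  · refine MvPolynomial.coeff_rename_eq_zero _ _ _ fun m hm => ?_
    exfalso
    apply hd
    intro i hi
    rw [← hm] at hi
    obtain ⟨j, -, rfl⟩ := Finset.mem_image.mp (Finsupp.mapDomain_support hi)
    exact j.2

theorem hasSum_toSeries_sub {Q : (r : ℕ) → MvPolynomial (Fin r) ℤ} {f : MvPowerSeries ℕ ℤ}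
    (h : ∀ r, restrictVars r f = (Q r : MvPowerSeries (Fin r) ℤ)) :
    HasSum (fun i => toSeries (Q (i + 1)) - toSeries (Q i)) (f - toSeries (Q 0)) := by
  classical
  rw [MvPowerSeries.WithPiTopology.hasSum_iff_hasSum_coeff]
  intro d
  obtain ⟨n, hn⟩ : ∃ n, ∀ i ∈ d.support, i < n :=
    ⟨d.support.sup id + 1, fun i hi => Nat.lt_succ_of_le (Finset.le_sup (f := id) hi)⟩
  have hc : ∀ k, n ≤ k → MvPowerSeries.coeff d (toSeries (Q k)) = MvPowerSeries.coeff d f :=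
    fun k hk => by
      rw [coeff_toSeries _ (h k), if_pos fun i hi => (hn i hi).trans_le hk]
  have hs := Finset.sum_range_sub (fun k => MvPowerSeries.coeff d (toSeries (Q k))) n
  rw [hc n le_rfl] at hs
  simp only [map_sub]
  rw [← hs]
  refine hasSum_sum_of_ne_finset_zero fun k hk => ?_
  have hk' : n ≤ k := by simpa using hk
  rw [hc k hk', hc (k + 1) (by omega), sub_self]

theorem toSeries_of_eval_eq_one {q : MvPolynomial (Fin 0) ℤ}
    (h : MvPolynomial.eval (fun _ => (1 : ℤ)) q = 1) : toSeries q = 1 := by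
  rw [MvPolynomial.eq_C_of_isEmpty q] at h ⊢
  rw [MvPolynomial.eval_C] at h
  rw [h, toSeries]
  simp

end ConcavePartition

theorem mainTheorem1 :
    ∃ Q : (r : ℕ) → MvPolynomial (Fin r) ℤ,
      (∀ r : ℕ,
        (IsUnit (ConcavePartition.denom r : MvPowerSeries (Fin r) ℤ) ∧
          ConcavePartition.PCr r * (ConcavePartition.denom r : MvPowerSeries (Fin r) ℤ) =
            (Q r : MvPowerSeries (Fin r) ℤ)) ∧
        MvPolynomial.eval (fun _ => (1 : ℤ)) (Q r) = 1 ∧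
        (∀ m ∈ (Q r).support, Antitone m) ∧
        Q r = ConcavePartition.setLastZero r (Q (r + 1))) ∧
      ∃ Qinf : MvPowerSeries ℕ ℤ,
        Multipliable ConcavePartition.denomFactor ∧
        IsUnit (∏' i, ConcavePartition.denomFactor i) ∧
        ConcavePartition.PC * ∏' i, ConcavePartition.denomFactor i = Qinf ∧
        (∀ r : ℕ, ConcavePartition.restrictVars r Qinf = (Q r : MvPowerSeries (Fin r) ℤ)) ∧
        HasSum (fun i : ℕ => ConcavePartition.toSeries (Q (i + 1)) -
          ConcavePartition.toSeries (Q i)) (Qinf - 1) := by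
  choose Q hQ h1 hanti using ConcavePartition.exists_polynomial_numerator
  have hres : ∀ r, ConcavePartition.restrictVars r
      (ConcavePartition.PC * ∏' i, ConcavePartition.denomFactor i) =
        (Q r : MvPowerSeries (Fin r) ℤ) := fun r => by
    rw [map_mul, ConcavePartition.restrictVars_PC,
      ConcavePartition.restrictVars_tprod_denomFactor, hQ]
  refine ⟨Q, fun r => ⟨⟨ConcavePartition.isUnit_coe_denom r, hQ r⟩, h1 r, hanti r, ?_⟩, _,
    ConcavePartition.multipliable_denomFactor, ConcavePartition.isUnit_tprod_denomFactor, rfl,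
    hres, ?_⟩
  · ext m
    rw [ConcavePartition.coeff_setLastZero, ← MvPolynomial.coeff_coe, ← MvPolynomial.coeff_coe,
      ← hres, ← hres, ConcavePartition.coeff_restrictVars, ConcavePartition.coeff_restrictVars,
      ConcavePartition.embDomain_castSucc]
  · rw [← ConcavePartition.toSeries_of_eval_eq_one (h1 0)]
    exact ConcavePartition.hasSum_toSeries_sub hres
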